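/- Let $\mathbb D=\{z\in\mathbb C:|z|<1\}$, and let $\gamma:S^1=\partial\mathbb D\to\mathbb C$ be a closed, continuous, piecewise smooth curve whose (one-sided) derivatives $\gamma'$ with respect to the angle $\theta$ vanish nowhere. A \emph{distorted disk bounded by $\gamma$} is a continuous map $F:\overline{\mathbb D}\to\mathbb C$ with $F|_{\partial\mathbb D}=\gamma$ whose restriction to $\mathbb D$ is an orientation-preserving immersion, i.e. is real differentiable with $\det \mathrm dF>0$ at every point of $\mathbb D$. The curve $\gamma$ is \emph{self-overlapping} if it bounds at least one distorted disk. The \emph{number of layers} of $F$ at $P\in\mathbb C$ is the number of points $z\in\mathbb D$ with $F(z)=P$. The winding number of $\gamma$ around $P\in\mathbb C\setminus\operatorname{Im}\gamma$ is $$\nu_\gamma(P)=\frac1{2i\pi}\int_0^{2\pi}\frac{\gamma'(\theta)}{\gamma(\theta)-P}\,\mathrm d\theta .$$ Proposition. Let $\gamma$ be self-overlapping, let $F$ be any distorted disk bounded by $\gamma$, and let $\Omega$ be any bounded connected component of $\mathbb C\setminus\operatorname{Im}\gamma$. Then the number of layers of $F$ is finite and takes the same value $\nu$ at all points of $\Omega$,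 and $\nu_\gamma(P)=\nu$ for every $P\in\Omega$. In particular, $\nu_\gamma(P)$ is a nonnegative integer for every $P\in\mathbb C\setminus\operatorname{Im}\gamma$. -/

import Mathlib

open scoped ContDiff

noncomputable section

namespace SelfOverlapping

/-- The angular parametrization `θ ↦ γ (e^{iθ})` of a closed curve `γ : S¹ → ℂ`. -/
def angular (γ : Circle → ℂ) (θ : ℝ) : ℂ := γ (Circle.exp θ)

/-- `γ` is a closed, continuous, piecewise smooth curve with nowhere vanishing velocity: `[0, 2π]`
is cut into finitely many closed intervals, on each of which `θ ↦ γ (e^{iθ})` is smooth up to the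
endpoints, with nonzero (at the endpoints: one-sided) derivative. Corners and self-intersections
are allowed. -/
def IsPiecewiseSmoothClosedCurve (γ : Circle → ℂ) : Prop :=
  Continuous γ ∧
    ∃ (n : ℕ) (t : ℕ → ℝ), t 0 = 0 ∧ t n = 2 * Real.pi ∧
      ∀ i < n, t i < t (i + 1) ∧
        ContDiffOn ℝ ∞ (angular γ) (Set.Icc (t i) (t (i + 1))) ∧
        ∀ θ ∈ Set.Icc (t i) (t (i + 1)),
          derivWithin (angular γ) (Set.Icc (t i) (t (i + 1))) θ ≠ 0

/-- The winding number `(1 / 2πi) ∫₀^{2π} γ'(θ) / (γ(θ) - P) dθ` of `γ` around `P`. It is only used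
for `P` off the curve; at the finitely many corners the integrand is irrelevant. -/
def windingNumber (γ : Circle → ℂ) (P : ℂ) : ℂ :=
  (2 * Real.pi * Complex.I)⁻¹ *
    ∫ θ in (0 : ℝ)..(2 * Real.pi), deriv (angular γ) θ / (angular γ θ - P)

/-- `F` is a distorted disk with continuous boundary values: a map that is continuous on the closed
unit disk and an orientation-preserving immersion of the open unit disk into the plane, that is to
say, real differentiable with differential of positive determinant at every point of the open disk.
(Only the values of `F` on the closed disk matter.) -/
structure IsDistortedDisk (F : ℂ → ℂ) : Prop where
  continuousOn : ContinuousOn F (Metric.closedBall 0 1)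
  differentiableAt : ∀ z ∈ Metric.ball (0 : ℂ) 1, DifferentiableAt ℝ F z
  det_pos : ∀ z ∈ Metric.ball (0 : ℂ) 1, 0 < (fderiv ℝ F z).det

/-- `γ` bounds the distorted disk `F`: `F` is a distorted disk whose restriction to the unit circle
is `γ`. -/
def Bounds (γ : Circle → ℂ) (F : ℂ → ℂ) : Prop :=
  IsDistortedDisk F ∧ ∀ u : Circle, F (u : ℂ) = γ u

/-- `γ` is self-overlapping: a closed piecewise smooth immersed curve that bounds a distorted
disk. -/
def IsSelfOverlapping (γ : Circle → ℂ) : Prop :=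
  IsPiecewiseSmoothClosedCurve γ ∧ ∃ F : ℂ → ℂ, Bounds γ F

/-- `Ω` is a bounded connected component of the complement of the image of `γ`. -/
def IsBoundedComponent (γ : Circle → ℂ) (Ω : Set ℂ) : Prop :=
  Bornology.IsBounded Ω ∧
    ∃ P ∈ (Set.range γ)ᶜ, Ω = connectedComponentIn (Set.range γ)ᶜ P

/-- The number of layers of the distorted disk `F` at `P`: the number, possibly infinite, of
preimages of `P` in the open unit disk. -/
def layersAt (F : ℂ → ℂ) (P : ℂ) : ℕ∞ :=
  {z ∈ Metric.ball (0 : ℂ) 1 | F z = P}.encard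

end SelfOverlapping

end

/-!
The index of a curve `f : S¹ → ℂ ∖ {0}` is the integer `n` in a factorization `f z = z ^ n * e ^ L`
with `L` continuous on the circle. At a zero of `F - P` the differential has the form
`h ↦ a h + b h̄` with `|b| < |a|`, hence `(F z - P) / (z - p)` stays near `p` in a disk around `a`
that misses `0`. Interpolating between this quotient and `a` removes the zero and divides the
boundary values by `z - p`, a factor of index `1`. Once all zeros are removed, what remains has a
continuous logarithm on the disk and index `0`, so the number of layers of `F` at `P` is the index
of `γ - P`. The index is unique and stable under small perturbations, which makes the number of
layers locally constant; the winding number is the variation of a continuous logarithm of `γ - P`.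
-/

namespace SelfOverlapping

open Complex Filter MeasureTheory Metric Set Topology

theorem exists_continuousMap_exp_eq {X : Type*} [TopologicalSpace X] [SimplyConnectedSpace X]
    [LocallyPathConnectedSpace X] {f : X → ℂ} (hf : Continuous f) (h0 : ∀ x, f x ≠ 0) :
    ∃ L : C(X, ℂ), ∀ x, exp (L x) = f x := by
  have huniv : IsSimplyConnected (univ : Set X) :=
    (Homeomorph.Set.univ X).toHomotopyEquiv.simplyConnectedSpace
  obtain ⟨L, hL, hexp⟩ := exists_continuousOn_eqOn_exp_comp huniv isOpen_univ hf.continuousOn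
    (by rintro ⟨x, -, hx⟩; exact h0 x hx)
  exact ⟨⟨L, continuousOn_univ.1 hL⟩, fun x => hexp (mem_univ x)⟩

theorem hasDerivAt_of_exp_comp_eq {Λ f : ℝ → ℂ} {t : ℝ} {f' : ℂ} (hΛ : ContinuousAt Λ t)
    (hexp : exp ∘ Λ =ᶠ[𝓝 t] f) (hf : HasDerivAt f f' t) : HasDerivAt Λ (f' / f t) t := by
  have hder : HasFDerivAt exp _ (Λ t) := (hasDerivAt_exp (Λ t)).hasFDerivAt.restrictScalars ℝ
  have hinv : Function.LeftInverse (ContinuousLinearMap.mul ℝ ℂ (exp (Λ t))⁻¹)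
      ((ContinuousLinearMap.toSpanSingleton ℂ (exp (Λ t))).restrictScalars ℝ) := fun w => by
    simp [field]
  convert! (hder.of_comp_of_leftInverse hΛ hf.hasFDerivAt hexp hinv).hasDerivAt using 1
  rw [← hexp.self_of_nhds]
  simp [div_eq_inv_mul]

/-- The curve `f : S¹ → ℂ ∖ {0}` has index `n` around `0`, that is, degree `n`. This is encoded by a
factorization through `z ↦ z ^ n` and a continuous logarithm on the whole circle, which makes sense
for curves that are merely continuous. -/
def HasIndex (f : Circle → ℂ) (n : ℤ) : Prop :=
  ∃ L : C(Circle, ℂ), ∀ z : Circle, f z = (z : ℂ) ^ n * exp (L z)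

section Index

variable {f g : Circle → ℂ} {m n : ℤ}

theorem HasIndex.continuous (hf : HasIndex f n) : Continuous f := by
  obtain ⟨L, hL⟩ := hf
  rw [funext hL]
  have hpow : Continuous fun z : Circle => (z : ℂ) ^ n :=
    Continuous.zpow₀ (by fun_prop) n fun z => Or.inl z.coe_ne_zero
  fun_prop

theorem HasIndex.ne_zero (hf : HasIndex f n) (z : Circle) : f z ≠ 0 := by
  obtain ⟨L, hL⟩ := hf
  rw [hL]
  exact mul_ne_zero (zpow_ne_zero n z.coe_ne_zero) (exp_ne_zero _)

theorem HasIndex.mul (hf : HasIndex f m) (hg : HasIndex g n) :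
    HasIndex (fun z => f z * g z) (m + n) := by
  obtain ⟨L, hL⟩ := hf
  obtain ⟨M, hM⟩ := hg
  refine ⟨L + M, fun z => ?_⟩
  simp only [hL, hM, zpow_add₀ z.coe_ne_zero, ContinuousMap.add_apply, exp_add]
  ring

theorem hasIndex_coe : HasIndex (fun z => (z : ℂ)) 1 :=
  ⟨0, fun z => by simp⟩

theorem hasIndex_zero_of_mem_slitPlane (hf : Continuous f) (hslit : ∀ z, f z ∈ slitPlane) :
    HasIndex f 0 :=
  ⟨⟨fun z => log (f z), hf.clog hslit⟩, fun z => by simp [exp_log (slitPlane_ne_zero (hslit z))]⟩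

theorem hasIndex_zero_of_ne_zero_on_closedBall {H : ℂ → ℂ}
    (hH : ContinuousOn H (closedBall 0 1)) (h0 : ∀ z ∈ closedBall (0 : ℂ) 1, H z ≠ 0) :
    HasIndex (fun z => H z) 0 := by
  have hconvex : Convex ℝ (closedBall (0 : ℂ) 1) := convex_closedBall 0 1
  have := hconvex.contractibleSpace ⟨0, by simp⟩
  have := hconvex.locallyPathConnectedSpace
  obtain ⟨L, hL⟩ := exists_continuousMap_exp_eq hH.domRestrict fun z => h0 z z.2
  have hmem (z : Circle) : (z : ℂ) ∈ closedBall 0 1 := by simp [z.norm_coe]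
  exact ⟨⟨fun z => L ⟨z, hmem z⟩, by fun_prop⟩, fun z => by simp [hL]⟩

theorem HasIndex.of_norm_sub_lt (hf : HasIndex f n) (hg : Continuous g)
    (hlt : ∀ z, ‖g z - f z‖ < ‖f z‖) : HasIndex g n := by
  have hquot : HasIndex (fun z => 1 + (g z - f z) / f z) 0 := by
    refine hasIndex_zero_of_mem_slitPlane ?_ fun z => mem_slitPlane_of_norm_lt_one ?_
    · exact continuous_const.add ((hg.sub hf.continuous).div hf.continuous hf.ne_zero)
    · rw [norm_div]
      exact (div_lt_one (norm_pos_iff.2 (hf.ne_zero z))).2 (hlt z)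
  convert! hf.mul hquot using 1
  · ext z
    rw [mul_add, mul_div_cancel₀ _ (hf.ne_zero z)]
    ring
  · ring

theorem hasIndex_coe_sub_const {p : ℂ} (hp : p ∈ ball (0 : ℂ) 1) :
    HasIndex (fun z => (z : ℂ) - p) 1 :=
  hasIndex_coe.of_norm_sub_lt (by fun_prop) (by simpa [Circle.norm_coe] using hp)

theorem HasIndex.eventually_sub_const {P : ℂ} (hf : HasIndex (fun z => f z - P) n) :
    ∀ᶠ Q in 𝓝 P, HasIndex (fun z => f z - Q) n := by
  have hcont : Continuous f := by
    simpa [Function.comp_def] using (continuous_add_const P).comp hf.continuous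
  have hclose : ∀ᶠ Q in 𝓝 P, ∀ z ∈ univ, ‖P - Q‖ < ‖f z - P‖ := by
    refine isCompact_univ.eventually_forall_of_forall_eventually fun z _ => ?_
    refine ContinuousAt.eventually_lt (by fun_prop) (by fun_prop) ?_
    simpa using hf.ne_zero z
  filter_upwards [hclose] with Q hQ
  refine hf.of_norm_sub_lt (by fun_prop) fun z => ?_
  simpa using hQ z (mem_univ z)

theorem HasIndex.exists_angular_log (hf : HasIndex f n) :
    ∃ Λ : ℝ → ℂ, Continuous Λ ∧ (∀ θ, exp (Λ θ) = angular f θ) ∧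
      Λ (2 * Real.pi) - Λ 0 = 2 * Real.pi * I * n := by
  obtain ⟨L, hL⟩ := hf
  refine ⟨fun θ => n * (θ * I) + L (Circle.exp θ), by fun_prop, fun θ => ?_, ?_⟩
  · rw [exp_add, exp_int_mul, angular, hL, Circle.coe_exp]
  · simp only [Circle.exp_two_pi, Circle.exp_zero]
    push_cast
    ring

theorem HasIndex.unique (hm : HasIndex f m) (hn : HasIndex f n) : m = n := by
  obtain ⟨Λ, hΛ, hexp, hvar⟩ := hm.exists_angular_log
  obtain ⟨M, hM, hexp', hvar'⟩ := hn.exists_angular_log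
  have hone (θ : ℝ) : exp ((Λ - M) θ) = 1 := by
    rw [Pi.sub_apply, exp_sub, hexp, hexp', div_self (hexp' θ ▸ exp_ne_zero _)]
  have hderiv (θ : ℝ) : HasDerivAt (Λ - M) 0 θ :=
    (hasDerivAt_of_exp_comp_eq (hΛ.sub hM).continuousAt (.of_forall hone)
      (hasDerivAt_const θ 1)).congr_deriv (zero_div _)
  have hconst : Λ (2 * Real.pi) - M (2 * Real.pi) = Λ 0 - M 0 :=
    is_const_of_deriv_eq_zero (fun θ => (hderiv θ).differentiableAt) (fun θ => (hderiv θ).deriv) _ _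
  have hcast : 2 * Real.pi * I * (m : ℂ) = 2 * Real.pi * I * n := by
    linear_combination hconst - hvar + hvar'
  exact_mod_cast mul_left_cancel₀ two_pi_I_ne_zero hcast

theorem HasIndex.windingNumber_eq {P : ℂ} (hf : HasIndex (fun z => f z - P) n)
    (hdiff : {θ ∈ Ioo 0 (2 * Real.pi) | ¬ DifferentiableAt ℝ (angular f) θ}.Countable)
    (hint : IntervalIntegrable (deriv (angular f)) volume 0 (2 * Real.pi)) :
    windingNumber f P = n := by
  have hcont : Continuous (angular fun z => f z - P) := hf.continuous.comp Circle.exp.continuous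
  obtain ⟨Λ, hΛ, hexp, hvar⟩ := hf.exists_angular_log
  have hderiv : ∀ θ ∈ Ioo 0 (2 * Real.pi) \
      {θ ∈ Ioo 0 (2 * Real.pi) | ¬ DifferentiableAt ℝ (angular f) θ},
      HasDerivAt Λ (deriv (angular f) θ / (angular f θ - P)) θ := by
    intro θ hθ
    have hd : DifferentiableAt ℝ (angular f) θ := by
      by_contra hd
      exact hθ.2 ⟨hθ.1, hd⟩
    exact hasDerivAt_of_exp_comp_eq hΛ.continuousAt (.of_forall hexp) (hd.hasDerivAt.sub_const P)
  have hint' : IntervalIntegrable (fun θ => deriv (angular f) θ / (angular f θ - P)) volume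
      0 (2 * Real.pi) :=
    hint.mul_continuousOn (hcont.inv₀ fun θ => hf.ne_zero _).continuousOn
  rw [windingNumber, integral_eq_of_hasDerivAt_off_countable_of_le Λ _ Real.two_pi_pos.le hdiff
    hΛ.continuousOn hderiv hint', hvar, inv_mul_cancel_left₀ two_pi_I_ne_zero]

end Index

theorem exists_continuousOn_eq_off_nhds {X E : Type*} [PseudoMetricSpace X]
    [NormedAddCommGroup E] [NormedSpace ℝ E] {q : X → E} {a : E} {ρ : ℝ} {K V : Set X} {p : X}
    (hρ : 0 ≤ ρ) (hq : ∀ x ∈ K, x ≠ p → ContinuousWithinAt q K x)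
    (hbound : ∀ᶠ x in 𝓝[≠] p, ‖q x - a‖ ≤ ρ) (hV : V ∈ 𝓝 p) :
    ∃ (H : X → E) (U : Set X), (U ∈ 𝓝 p ∧ U ⊆ V) ∧ ContinuousOn H K ∧
      (∀ x ∈ U, ‖H x - a‖ ≤ ρ) ∧ ∀ x ∉ U, H x = q x := by
  obtain ⟨δ, hδ, hball⟩ :=
    nhds_basis_ball.mem_iff.1 (inter_mem (eventually_nhdsWithin_iff.1 hbound) hV)
  let χ : X → ℝ := fun x => min 1 (dist x p / δ)
  let H : X → E := fun x => a + χ x • (q x - a)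
  have hχ : Continuous χ := by fun_prop
  have hχp : χ p = 0 := by simp [χ]
  have hχ0 (x : X) : 0 ≤ χ x := le_min zero_le_one (by positivity)
  have hnear : ∀ x ∈ ball p δ, ‖H x - a‖ ≤ χ x * ρ := by
    intro x hx
    obtain rfl | hne := eq_or_ne x p
    · simp [H, hχp]
    · simpa [H, norm_smul, abs_of_nonneg (hχ0 x)] using
        mul_le_mul_of_nonneg_left ((hball hx).1 hne) (hχ0 x)
  refine ⟨H, ball p δ, ⟨ball_mem_nhds p hδ, fun x hx => (hball hx).2⟩, fun x hx => ?_,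
    fun x hx => ?_, fun x hx => ?_⟩
  · obtain rfl | hne := eq_or_ne x p
    · refine ContinuousAt.continuousWithinAt (tendsto_iff_norm_sub_tendsto_zero.2 ?_)
      have hHx : H x = a := by simp [H, hχp]
      rw [hHx]
      refine squeeze_zero' (.of_forall fun _ => norm_nonneg _)
        (eventually_of_mem (ball_mem_nhds x hδ) hnear) ?_
      simpa [hχp] using (hχ.tendsto x).mul_const ρ
    · exact continuousWithinAt_const.add
        (hχ.continuousWithinAt.smul ((hq x hx hne).sub continuousWithinAt_const))
  · exact (hnear x hx).trans (mul_le_of_le_one_left hρ (min_le_left _ _))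
  · have hχx : χ x = 1 := min_eq_left ((one_le_div hδ).2 (not_lt.1 hx))
    simp [H, hχx]

/-- A zero `p` of `G` of local index `1`: near `p`, `G` stays in a cone around a nonzero
complex-linear map. Unlike invertibility of the differential, this survives multiplication by
functions that are only continuous. That `G p = 0` is the case `z = p` of the estimate. -/
def IsPositiveSimpleZero (G : ℂ → ℂ) (p : ℂ) : Prop :=
  ∃ a : ℂ, ∃ ρ ∈ Ico 0 ‖a‖, ∀ᶠ z in 𝓝 p, ‖G z - a * (z - p)‖ ≤ ρ * ‖z - p‖

theorem exists_eq_mul_add_mul_conj (A : ℂ →L[ℝ] ℂ) :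
    ∃ a b : ℂ, A.det = ‖a‖ ^ 2 - ‖b‖ ^ 2 ∧ ∀ h, A h = a * h + b * (starRingEnd ℂ) h := by
  have hdet : A.det = (A 1).re * (A I).im - (A I).re * (A 1).im := by
    rw [ContinuousLinearMap.det, ← LinearMap.det_toMatrix basisOneI, Matrix.det_fin_two]
    simp [LinearMap.toMatrix_apply]
  have hA (h : ℂ) : A h = h.re * A 1 + h.im * A I := by
    conv_lhs => rw [show h = h.re • (1 : ℂ) + h.im • I by simp [re_add_im]]
    rw [map_add, map_smul, map_smul, real_smul, real_smul]
  refine ⟨(A 1 - I * A I) / 2, (A 1 + I * A I) / 2, ?_, fun h => ?_⟩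
  · rw [hdet, ← normSq_eq_norm_sq, ← normSq_eq_norm_sq]
    simp only [normSq_apply, div_ofNat_re, div_ofNat_im, sub_re, sub_im, add_re, add_im, I_mul_re,
      I_mul_im]
    ring
  · have hconj : (starRingEnd ℂ) h = h.re - h.im * I := by
      apply Complex.ext <;> simp
    rw [hA, hconj]
    nth_rw 3 [← re_add_im h]
    linear_combination h.im * A I * I_sq

section PositiveSimpleZero

variable {G : ℂ → ℂ} {p : ℂ}

theorem isPositiveSimpleZero_of_hasFDerivAt {A : ℂ →L[ℝ] ℂ} (hG : HasFDerivAt G A p)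
    (hp : G p = 0) (hA : 0 < A.det) : IsPositiveSimpleZero G p := by
  obtain ⟨a, b, hdet, hab⟩ := exists_eq_mul_add_mul_conj A
  have hlt : ‖b‖ < ‖a‖ := lt_of_pow_lt_pow_left₀ 2 (norm_nonneg a) (by linarith)
  obtain ⟨ρ, hbρ, hρa⟩ := exists_between hlt
  refine ⟨a, ρ, ⟨(norm_nonneg b).trans hbρ.le, hρa⟩, ?_⟩
  filter_upwards [(hasFDerivAt_iff_isLittleO.1 hG).bound (sub_pos.2 hbρ)] with z hz
  rw [hp, sub_zero] at hz
  calc ‖G z - a * (z - p)‖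
      = ‖(G z - A (z - p)) + b * (starRingEnd ℂ) (z - p)‖ := by rw [hab]; ring_nf
    _ ≤ (ρ - ‖b‖) * ‖z - p‖ + ‖b‖ * ‖z - p‖ := by
        refine (norm_add_le _ _).trans (add_le_add hz ?_)
        rw [norm_mul, RCLike.norm_conj]
    _ = ρ * ‖z - p‖ := by ring

theorem IsPositiveSimpleZero.eventually_ne_zero (hG : IsPositiveSimpleZero G p) :
    ∀ᶠ z in 𝓝[≠] p, G z ≠ 0 := by
  obtain ⟨a, ρ, hρ, hev⟩ := hG
  filter_upwards [hev.filter_mono nhdsWithin_le_nhds, self_mem_nhdsWithin] with z hz hne hzero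
  rw [hzero, zero_sub, norm_neg, norm_mul] at hz
  exact hρ.2.not_ge (le_of_mul_le_mul_right hz (norm_pos_iff.2 (sub_ne_zero.2 hne)))

theorem IsPositiveSimpleZero.congr {G' : ℂ → ℂ} (hG : IsPositiveSimpleZero G p)
    (heq : G' =ᶠ[𝓝 p] G) : IsPositiveSimpleZero G' p := by
  obtain ⟨a, ρ, hρ, hev⟩ := hG
  refine ⟨a, ρ, hρ, ?_⟩
  filter_upwards [hev, heq] with z hz hGz
  rwa [hGz]

theorem IsPositiveSimpleZero.mul {u : ℂ → ℂ} (hG : IsPositiveSimpleZero G p)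
    (hu : ContinuousAt u p) (hp : u p ≠ 0) : IsPositiveSimpleZero (fun z => u z * G z) p := by
  obtain ⟨a, ρ, ⟨hρ, hρa⟩, hev⟩ := hG
  have hlt : ‖u p‖ * ρ < ‖u p * a‖ := by
    rw [norm_mul]
    exact mul_lt_mul_of_pos_left hρa (norm_pos_iff.2 hp)
  obtain ⟨σ, hσ, hσa⟩ := exists_between hlt
  have hclose : ∀ᶠ z in 𝓝 p, ‖u z‖ * ρ + ‖u z - u p‖ * ‖a‖ < σ :=
    ContinuousAt.eventually_lt (by fun_prop) continuousAt_const (by simpa using hσ)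
  refine ⟨u p * a, σ, ⟨(mul_nonneg (norm_nonneg _) hρ).trans hσ.le, hσa⟩, ?_⟩
  filter_upwards [hev, hclose] with z hz hσz
  calc ‖u z * G z - u p * a * (z - p)‖
      = ‖u z * (G z - a * (z - p)) + (u z - u p) * a * (z - p)‖ := by ring_nf
    _ ≤ ‖u z‖ * ‖G z - a * (z - p)‖ + ‖u z - u p‖ * ‖a‖ * ‖z - p‖ := by
        simpa only [norm_mul] using
          norm_add_le (u z * (G z - a * (z - p))) ((u z - u p) * a * (z - p))
    _ ≤ ‖u z‖ * (ρ * ‖z - p‖) + ‖u z - u p‖ * ‖a‖ * ‖z - p‖ := by gcongr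
    _ = (‖u z‖ * ρ + ‖u z - u p‖ * ‖a‖) * ‖z - p‖ := by ring
    _ ≤ σ * ‖z - p‖ := by gcongr

theorem IsPositiveSimpleZero.exists_continuousOn_factor {K V : Set ℂ}
    (hp : IsPositiveSimpleZero G p) (hG : ContinuousOn G K) (hV : V ∈ 𝓝 p) :
    ∃ H : ℂ → ℂ, ContinuousOn H K ∧ (∀ z, H z = 0 → z ≠ p ∧ G z = 0) ∧
      ∀ z ∉ V, G z = (z - p) * H z := by
  obtain ⟨a, ρ, hρ, hev⟩ := hp
  have hquot : ∀ᶠ z in 𝓝[≠] p, ‖G z / (z - p) - a‖ ≤ ρ := by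
    filter_upwards [hev.filter_mono nhdsWithin_le_nhds, self_mem_nhdsWithin] with z hz hne
    have hzp : z - p ≠ 0 := sub_ne_zero.2 hne
    rwa [div_sub' hzp, norm_div, div_le_iff₀ (norm_pos_iff.2 hzp), mul_comm (z - p)]
  obtain ⟨H, U, hU, hH, hnear, hfar⟩ := exists_continuousOn_eq_off_nhds
    (q := fun z => G z / (z - p)) hρ.1
    (fun z hz hne => (hG z hz).div (by fun_prop) (sub_ne_zero.2 hne)) hquot hV
  have hHU : ∀ z ∈ U, H z ≠ 0 := by
    intro z hz h0
    have hle : ‖a‖ ≤ ρ := by simpa [h0] using hnear z hz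
    exact hρ.2.not_ge hle
  refine ⟨H, hH, fun z hz => ?_, fun z hz => ?_⟩
  · have hzU : z ∉ U := fun hzU => hHU z hzU hz
    have hne : z ≠ p := fun h => hzU (h ▸ mem_of_mem_nhds hU.1)
    exact ⟨hne, by simpa [hfar z hzU, sub_ne_zero.2 hne] using hz⟩
  · have hne : z ≠ p := fun h => hz (h ▸ mem_of_mem_nhds hV)
    rw [hfar z fun hzU => hz (hU.2 hzU), mul_div_cancel₀ _ (sub_ne_zero.2 hne)]

end PositiveSimpleZero

section ArgumentPrinciple

theorem finite_zeros_of_eventually_ne_zero {X Y : Type*} [TopologicalSpace X] [T2Space X]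
    [TopologicalSpace Y] [T1Space Y] [Zero Y] {K : Set X} {G : X → Y} (hK : IsCompact K)
    (hG : ContinuousOn G K) (hne : ∀ x ∈ K, G x = 0 → ∀ᶠ y in 𝓝[≠] x, G y ≠ 0) :
    {x ∈ K | G x = 0}.Finite := by
  have hcompact : IsCompact {x ∈ K | G x = 0} :=
    hK.of_isClosed_subset (hG.preimage_isClosed_of_isClosed hK.isClosed isClosed_singleton)
      (sep_subset _ _)
  by_contra hinf
  obtain ⟨x, ⟨hxK, hx⟩, hacc⟩ := Infinite.exists_accPt_of_subset_isCompact hinf hcompact subset_rfl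
  obtain ⟨y, hy, hy0⟩ := ((accPt_iff_frequently_nhdsNE.1 hacc).and_eventually (hne x hxK hx)).exists
  exact hy0 hy.2

variable {G : ℂ → ℂ}

theorem hasIndex_card_of_zeros_subset {S : Finset ℂ} (hG : ContinuousOn G (closedBall 0 1))
    (hzero : ∀ z ∈ closedBall (0 : ℂ) 1, G z = 0 → z ∈ S) (hS : ∀ p ∈ S, p ∈ ball (0 : ℂ) 1)
    (hpos : ∀ p ∈ S, IsPositiveSimpleZero G p) : HasIndex (fun z => G z) S.card := by
  classical
  induction S using Finset.induction_on generalizing G with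
  | empty =>
    exact hasIndex_zero_of_ne_zero_on_closedBall hG fun z hz h0 =>
      Finset.notMem_empty z (hzero z hz h0)
  | insert p S hpS ih =>
    rw [Finset.forall_mem_insert] at hS hpos
    have hfar : (sphere (0 : ℂ) 1 ∪ S)ᶜ ∈ 𝓝 p :=
      (isClosed_sphere.union S.finite_toSet.isClosed).isOpen_compl.mem_nhds <| by
        simpa [hpS] using (mem_ball_zero_iff.1 hS.1).ne
    obtain ⟨δ, hδ, hball⟩ := nhds_basis_closedBall.mem_iff.1 hfar
    obtain ⟨H, hH, hHzero, hfactor⟩ :=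
      hpos.1.exists_continuousOn_factor hG (closedBall_mem_nhds p hδ)
    have hHpos : ∀ q ∈ S, IsPositiveSimpleZero H q := by
      intro q hq
      have hqp : q - p ≠ 0 := sub_ne_zero.2 fun h => hpS (h ▸ hq)
      have hqδ : q ∉ closedBall p δ := fun h => hball h (Or.inr hq)
      refine ((hpos.2 q hq).mul (u := fun z => (z - p)⁻¹) ?_ (inv_ne_zero hqp)).congr ?_
      · exact ContinuousAt.inv₀ (by fun_prop) hqp
      · filter_upwards [isClosed_closedBall.isOpen_compl.mem_nhds hqδ,
          eventually_ne_nhds (sub_ne_zero.1 hqp)] with z hz hzp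
        rw [hfactor z hz, inv_mul_cancel_left₀ (sub_ne_zero.2 hzp)]
    have hindex : HasIndex (fun z => H z) S.card := by
      refine ih hH (fun z hz h0 => ?_) hS.2 hHpos
      obtain ⟨hzp, hGz⟩ := hHzero z h0
      exact Finset.mem_of_mem_insert_of_ne (hzero z hz hGz) hzp
    have hcircle (z : Circle) : G z = (z - p) * H z :=
      hfactor z fun h => hball h (Or.inl (mem_sphere_zero_iff_norm.2 z.norm_coe))
    simpa [hcircle, Finset.card_insert_of_notMem hpS, add_comm] using
      (hasIndex_coe_sub_const hS.1).mul hindex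

theorem exists_encard_zeros_eq_and_hasIndex (hG : ContinuousOn G (closedBall 0 1))
    (hball : ∀ z ∈ closedBall (0 : ℂ) 1, G z = 0 → z ∈ ball (0 : ℂ) 1)
    (hpos : ∀ z ∈ ball (0 : ℂ) 1, G z = 0 → IsPositiveSimpleZero G z) :
    ∃ k : ℕ, {z ∈ ball (0 : ℂ) 1 | G z = 0}.encard = k ∧ HasIndex (fun z => G z) k := by
  have hfin : {z ∈ ball (0 : ℂ) 1 | G z = 0}.Finite :=
    (finite_zeros_of_eventually_ne_zero (isCompact_closedBall 0 1) hG fun z hz h0 =>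
      (hpos z (hball z hz h0) h0).eventually_ne_zero).subset fun z hz =>
        ⟨ball_subset_closedBall hz.1, hz.2⟩
  refine ⟨hfin.toFinset.card, hfin.encard_eq_coe_toFinset_card, ?_⟩
  refine hasIndex_card_of_zeros_subset hG (fun z hz h0 => ?_) (fun p hp => ?_) fun p hp => ?_
  · exact hfin.mem_toFinset.2 ⟨hball z hz h0, h0⟩
  · exact (hfin.mem_toFinset.1 hp).1
  · exact hpos p (hfin.mem_toFinset.1 hp).1 (hfin.mem_toFinset.1 hp).2

end ArgumentPrinciple

section Layers

variable {γ : Circle → ℂ} {F : ℂ → ℂ} {P : ℂ}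

theorem Bounds.exists_layersAt_eq_and_hasIndex (hF : Bounds γ F) (hP : P ∈ (range γ)ᶜ) :
    ∃ k : ℕ, layersAt F P = k ∧ HasIndex (fun z => γ z - P) k := by
  obtain ⟨hdisk, hboundary⟩ := hF
  have hball : ∀ z ∈ closedBall (0 : ℂ) 1, F z - P = 0 → z ∈ ball (0 : ℂ) 1 := by
    intro z hz h0
    rw [mem_ball_zero_iff]
    refine (mem_closedBall_zero_iff.1 hz).lt_of_ne fun hnorm => hP ?_
    let u : Circle := ⟨z, mem_sphere_zero_iff_norm.2 hnorm⟩
    exact ⟨u, (hboundary u).symm.trans (sub_eq_zero.1 h0)⟩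
  have hpos : ∀ z ∈ ball (0 : ℂ) 1, F z - P = 0 → IsPositiveSimpleZero (fun z => F z - P) z :=
    fun z hz h0 => isPositiveSimpleZero_of_hasFDerivAt
      ((hdisk.differentiableAt z hz).hasFDerivAt.sub_const P) h0 (hdisk.det_pos z hz)
  obtain ⟨k, hcard, hindex⟩ := exists_encard_zeros_eq_and_hasIndex (G := fun z => F z - P)
    (hdisk.continuousOn.sub continuousOn_const) hball hpos
  exact ⟨k, by simpa only [layersAt, sub_eq_zero] using hcard,
    by simpa only [hboundary] using hindex⟩

theorem Bounds.eventually_layersAt_eq (hF : Bounds γ F) (hP : P ∈ (range γ)ᶜ) :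
    ∀ᶠ Q in 𝓝 P, layersAt F P = layersAt F Q := by
  obtain ⟨k, hk, hindex⟩ := hF.exists_layersAt_eq_and_hasIndex hP
  filter_upwards [hindex.eventually_sub_const] with Q hindexQ
  have hQ : Q ∈ (range γ)ᶜ := by
    rintro ⟨z, hz⟩
    exact hindexQ.ne_zero z (sub_eq_zero.2 hz)
  obtain ⟨l, hl, hindex'⟩ := hF.exists_layersAt_eq_and_hasIndex hQ
  rw [hk, hl, Nat.cast_inj.1 (hindexQ.unique hindex')]

theorem Bounds.layersAt_eq_of_isPreconnected (hF : Bounds γ F) {U : Set ℂ} (hU : IsPreconnected U)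
    (hUγ : U ⊆ (range γ)ᶜ) {Q : ℂ} (hP : P ∈ U) (hQ : Q ∈ U) : layersAt F P = layersAt F Q :=
  hU.induction₂ (fun P Q => layersAt F P = layersAt F Q)
    (fun _ hP => (hF.eventually_layersAt_eq (hUγ hP)).filter_mono nhdsWithin_le_nhds)
    (fun _ _ _ _ _ _ => Eq.trans) (fun _ _ _ _ => Eq.symm) hP hQ

theorem Bounds.exists_layersAt_eq_and_windingNumber_eq (hF : Bounds γ F)
    (hdiff : {θ ∈ Ioo 0 (2 * Real.pi) | ¬ DifferentiableAt ℝ (angular γ) θ}.Countable)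
    (hint : IntervalIntegrable (deriv (angular γ)) volume 0 (2 * Real.pi))
    (hP : P ∈ (range γ)ᶜ) : ∃ k : ℕ, layersAt F P = k ∧ windingNumber γ P = k := by
  obtain ⟨k, hk, hindex⟩ := hF.exists_layersAt_eq_and_hasIndex hP
  exact ⟨k, hk, by simpa using hindex.windingNumber_eq hdiff hint⟩

end Layers

theorem IsPiecewiseSmoothClosedCurve.countable_not_differentiableAt {γ : Circle → ℂ}
    (hγ : IsPiecewiseSmoothClosedCurve γ) :
    {θ ∈ Ioo 0 (2 * Real.pi) | ¬ DifferentiableAt ℝ (angular γ) θ}.Countable := by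
  obtain ⟨-, n, t, h0, hn, hpieces⟩ := hγ
  refine (countable_range t).mono ?_
  rintro θ ⟨hθ, hnot⟩
  rw [← h0, ← hn] at hθ
  obtain ⟨i, hlt, hi, hle⟩ : ∃ i, t i < θ ∧ i < n ∧ θ ≤ t (i + 1) := by
    simpa using Ioc_subset_biUnion_Ioc n t (Ioo_subset_Ioc_self hθ)
  obtain ⟨-, hsmooth, -⟩ := hpieces i hi
  refine ⟨i + 1, (hle.eq_of_not_lt fun hlt' => hnot ?_).symm⟩
  exact (hsmooth.differentiableOn (by simp)).differentiableAt (Icc_mem_nhds hlt hlt')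

theorem IsPiecewiseSmoothClosedCurve.intervalIntegrable_deriv {γ : Circle → ℂ}
    (hγ : IsPiecewiseSmoothClosedCurve γ) :
    IntervalIntegrable (deriv (angular γ)) volume 0 (2 * Real.pi) := by
  obtain ⟨-, n, t, h0, hn, hpieces⟩ := hγ
  rw [← h0, ← hn]
  refine IntervalIntegrable.trans_iterate fun i hi => ?_
  obtain ⟨hlt, hsmooth, -⟩ := hpieces i hi
  have hcont : ContinuousOn (derivWithin (angular γ) (Icc (t i) (t (i + 1))))
      (Icc (t i) (t (i + 1))) :=
    hsmooth.continuousOn_derivWithin (uniqueDiffOn_Icc hlt) (by simp)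
  refine (hcont.intervalIntegrable_of_Icc hlt.le).congr_uIoo fun θ hθ => ?_
  rw [uIoo_of_le hlt.le] at hθ
  exact derivWithin_of_mem_nhds (Icc_mem_nhds hθ.1 hθ.2)

end SelfOverlapping

theorem mainTheorem5_general {γ : Circle → ℂ} {F : ℂ → ℂ} (hF : SelfOverlapping.Bounds γ F)
    (hdiff : {θ ∈ Set.Ioo 0 (2 * Real.pi) |
      ¬ DifferentiableAt ℝ (SelfOverlapping.angular γ) θ}.Countable)
    (hint : IntervalIntegrable (deriv (SelfOverlapping.angular γ)) MeasureTheory.volume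
      0 (2 * Real.pi))
    {P : ℂ} (hP : P ∈ (Set.range γ)ᶜ) :
    ∃ ν : ℕ,
      (∀ Q ∈ connectedComponentIn (Set.range γ)ᶜ P, SelfOverlapping.layersAt F Q = (ν : ℕ∞)) ∧
      ∀ Q ∈ connectedComponentIn (Set.range γ)ᶜ P,
        SelfOverlapping.windingNumber γ Q = (ν : ℂ) := by
  have hsub := connectedComponentIn_subset (Set.range γ)ᶜ P
  obtain ⟨ν, hν, -⟩ := hF.exists_layersAt_eq_and_windingNumber_eq hdiff hint hP
  have hlayers : ∀ Q ∈ connectedComponentIn (Set.range γ)ᶜ P,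
      SelfOverlapping.layersAt F Q = (ν : ℕ∞) := fun Q hQ =>
    (hF.layersAt_eq_of_isPreconnected isPreconnected_connectedComponentIn hsub hQ
      (mem_connectedComponentIn hP)).trans hν
  refine ⟨ν, hlayers, fun Q hQ => ?_⟩
  obtain ⟨k, hk, hwinding⟩ := hF.exists_layersAt_eq_and_windingNumber_eq hdiff hint (hsub hQ)
  rwa [Nat.cast_injective (hk.symm.trans (hlayers Q hQ))] at hwinding

theorem mainTheorem5 (γ : Circle → ℂ) (hγ : SelfOverlapping.IsSelfOverlapping γ) :
    (∀ F : ℂ → ℂ, SelfOverlapping.Bounds γ F →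
      ∀ Ω : Set ℂ, SelfOverlapping.IsBoundedComponent γ Ω →
        ∃ ν : ℕ, (∀ P ∈ Ω, SelfOverlapping.layersAt F P = (ν : ℕ∞)) ∧
          ∀ P ∈ Ω, SelfOverlapping.windingNumber γ P = (ν : ℂ)) ∧
    ∀ P ∈ (Set.range γ)ᶜ, ∃ k : ℕ, SelfOverlapping.windingNumber γ P = (k : ℂ) := by
  obtain ⟨hγ, F₀, hF₀⟩ := hγ
  have hcomponent {F : ℂ → ℂ} (hF : SelfOverlapping.Bounds γ F) {P : ℂ} (hP : P ∈ (Set.range γ)ᶜ) :=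
    mainTheorem5_general hF hγ.countable_not_differentiableAt hγ.intervalIntegrable_deriv hP
  refine ⟨fun F hF Ω ⟨_, P, hP, hΩ⟩ => hΩ ▸ hcomponent hF hP, fun P hP => ?_⟩
  obtain ⟨ν, -, hν⟩ := hcomponent hF₀ hP
  exact ⟨ν, hν P (mem_connectedComponentIn hP)⟩
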